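/- Let $G=(V,E)$ be a finite acyclic directed multigraph with unit-capacity channels, a single source node $s$ without incoming channels, and a set $T\not\ni s$ of sink nodes without outgoing channels; for $t\in T$ let $C_t$ be the minimum cut capacity between $s$ and $t$. Let $\mathcal F$ be a finite field and $\omega\ge 1$ an integer with $\omega\le C_t$ for all $t\in T$. An $n$-dimensional ($\mathcal F$-valued) linear network error correction code on $G$ is given by local encoding kernels $K_i=[k_{d,e}]_{d\in In(i),\,e\in Out(i)}$ over $\mathcal F$ at all nodes $i\notin T$, where $In(s)$ consists of $n$ imaginary message channels $d_1',\dots,d_n'$. Its extended global encoding kernels $\tilde f_e\in\mathcal F^{\,n+|E|}$, with coordinates indexed by $In(s)\cup E$, are determined by $\tilde f_{d_i'}=1_{d_i'}$ and $\tilde f_e=\sum_{d\in In(tail(e))}k_{d,e}\tilde f_d+1_e$ for $e\in E$, where $1_d$ denotes a standard unit vector. For $t\in T$ let $\tilde F_t=[\tilde f_e : e\in In(t)]=\begin{bmatrix}F_t\\ G_t\end{bmatrix}$, where $F_t$ has the rows indexed by $In(s)$ and $G_t$ those indexed by $E$. Put $\Phi(t)=\{X F_t: X\in\mathcal F^n\}$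 and, for an error pattern $\rho\subseteq E$, $\Delta(t,\rho)=\{Z G_t: Z\in\mathcal F^{E},\ Z_e=0 \text{ for } e\notin\rho\}$. The rank $rank_t(\rho)$ is the least $|\rho'|$ over the error patterns $\rho'$ such that $\Delta(t,\rho)\subseteq\Delta(t,\rho')$ for every linear network code over $\mathcal F$. A code is regular if $\dim\Phi(t)=n$ for all $t\in T$. A network MDS code of dimension $n\geq 1$ is a regular code such that, for all $t\in T$, $$\min\{rank_t(\rho):\ \dim(\Delta(t,\rho)\cap\Phi(t))>0\}=C_t-n+1 .$$ Let $R_t(\delta)$ be the set of error patterns $\rho$ with $|\rho|=rank_t(\rho)=\delta$. Theorem. If $$|\mathcal F|>\max_{0\le i\le\omega-1}\ \sum_{t\in T}|R_t(C_t-\omega+i)|,$$ then there is a family of variable-rate $\mathcal F$-valued network MDS codes of dimensions $1,2,\dots,\omega$: for each $n\in\{1,\dots,\omega\}$ there is an $n$-dimensional $\mathcal F$-valued network MDS code on $G$, and these $\omega$ codes have the same local encoding kernel at every internal node (every node of $V\setminus(\{s\}\cup T)$). -/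

import Mathlib

/-- A single source finite acyclic multicast network: `V` is the set of nodes, `E` is the set of
(unit capacity) channels, parallel channels being allowed.  The source has no incoming channels
and the sinks have no outgoing channels. -/
structure MulticastNetwork (V E : Type*) where
  /-- the node that a channel leaves -/
  tail : E → V
  /-- the node that a channel enters -/
  head : E → V
  /-- the source node -/
  source : V
  /-- the set of sink nodes -/
  sinks : Finset V
  source_notMem_sinks : source ∉ sinks
  head_ne_source : ∀ e, head e ≠ source
  tail_notMem_sinks : ∀ e, tail e ∉ sinks
  acyclic : ∀ v, ¬ Relation.TransGen (fun i j => ∃ e, tail e = i ∧ head e = j) v v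

namespace MulticastNetwork

variable {V E : Type*} (N : MulticastNetwork V E)

/-- The incoming channels of a node. -/
abbrev In (i : V) : Type _ := {e : E // N.head e = i}

/-- The outgoing channels of a node. -/
abbrev Out (i : V) : Type _ := {e : E // N.tail e = i}

/-- The nodes that are neither the source nor a sink. -/
def internalNodes : Set V := {i | i ≠ N.source ∧ i ∉ N.sinks}

/-- `A` is a cut between `i` and `j`: after the removal of the channels in `A`, no directed path
leads from `i` to `j`. -/
def IsCut (A : Finset E) (i j : V) : Prop :=
  ¬ Relation.ReflTransGen (fun u v => ∃ e, e ∉ A ∧ N.tail e = u ∧ N.head e = v) i j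

/-- The minimum cut capacity between two (distinct) nodes. -/
noncomputable def minCut (i j : V) : ℕ :=
  sInf {m | ∃ A : Finset E, N.IsCut A i j ∧ A.card = m}

/-- The minimum cut capacity `C_t` between the source and the node `t`. -/
noncomputable def capacity (t : V) : ℕ := N.minCut N.source t

/-- The channel `d` enters the node that the channel `e` leaves. -/
def Adjacent (d e : E) : Prop := N.head d = N.tail e

theorem adjacent_wellFounded [Finite E] : WellFounded N.Adjacent := by
  have hirr : ∀ e, ¬ Relation.TransGen N.Adjacent e e := fun e he =>
    N.acyclic (N.tail e) (he.lift N.tail fun d _ h => ⟨d, rfl, h⟩)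
  have : Std.Irrefl (Relation.TransGen N.Adjacent) := ⟨hirr⟩
  exact Subrelation.wf (fun h => Relation.TransGen.single h)
    (Finite.wellFounded_of_trans_of_irrefl (Relation.TransGen N.Adjacent))

end MulticastNetwork

/-- An `n`-dimensional `F`-valued linear network error correction code, in its local description:
the local encoding kernel at the source, whose rows are indexed by the `n` imaginary message
channels, and the local encoding kernels at the other nodes.  (At the source and at the sinks
`kernel` is an empty matrix, since the source has no incoming channels in `E` and a sink has no
outgoing channels.) -/
structure NetworkCode {V E : Type*} (N : MulticastNetwork V E) (F : Type*) (n : ℕ) where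
  /-- the local encoding kernel at the source -/
  sourceKernel : Matrix (Fin n) (N.Out N.source) F
  /-- the local encoding kernel at a node other than the source -/
  kernel : (i : V) → Matrix (N.In i) (N.Out i) F

namespace NetworkCode

variable {V E F : Type*} [Fintype E] [DecidableEq V] [DecidableEq E] [Field F]
  {N : MulticastNetwork V E} {n : ℕ} (C : NetworkCode N F n)

/-- The extended global encoding kernel `f̃_e` of the channel `e`, a column vector with entries
indexed by the `n` imaginary message channels and the channels in `E`. It is determined by
`f̃_e = ∑_{d ∈ In(tail(e))} k_{d,e} f̃_d + 1_e`, where `In(s)` consists of the imaginary message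
channels, whose kernels are standard unit vectors. -/
noncomputable def extKernel (e : E) : Fin n ⊕ E → F :=
  (if h : N.tail e = N.source then
    ∑ i : Fin n, C.sourceKernel i ⟨e, h⟩ • (Pi.single (Sum.inl i) 1 : Fin n ⊕ E → F)
  else
    ∑ d : N.In (N.tail e), C.kernel (N.tail e) d ⟨e, rfl⟩ • extKernel d.1)
  + Pi.single (Sum.inr e) 1
termination_by N.adjacent_wellFounded.wrap e
decreasing_by exact d.2

/-- The decoding matrix `F̃_t` at the node `t`, with columns `f̃_e` for `e ∈ In(t)`. -/
noncomputable def decodingMatrix (t : V) : Matrix (Fin n ⊕ E) (N.In t) F :=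
  Matrix.of fun d e => C.extKernel e.1 d

/-- The upper block `F_t` of the decoding matrix: rows of the imaginary message channels. -/
noncomputable def messageMatrix (t : V) : Matrix (Fin n) (N.In t) F :=
  (C.decodingMatrix t).submatrix Sum.inl id

/-- The lower block `G_t` of the decoding matrix: rows of the channels in `E`. -/
noncomputable def errorMatrix (t : V) : Matrix E (N.In t) F :=
  (C.decodingMatrix t).submatrix Sum.inr id

/-- The message space `Φ(t)`, the set of all `X · F_t`. -/
noncomputable def messageSpace (t : V) : Submodule F (N.In t → F) :=
  LinearMap.range (C.messageMatrix t).vecMulLinear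

/-- The error space `Δ(t,p)` of the error pattern `p`, the set of all `Z · G_t` with `Z` matching
`p`, that is, with `Z e = 0` for `e ∉ p`. -/
noncomputable def errorSpace (t : V) (p : Finset E) : Submodule F (N.In t → F) :=
  (Submodule.pi {e : E | e ∉ p} fun _ => (⊥ : Submodule F F)).map (C.errorMatrix t).vecMulLinear

/-- A code is regular if its message space has full dimension at every sink. -/
def IsRegular : Prop := ∀ t ∈ N.sinks, Module.finrank F (C.messageSpace t) = n

theorem mem_messageSpace {t : V} {y : N.In t → F} :
    y ∈ C.messageSpace t ↔ ∃ X : Fin n → F, Matrix.vecMul X (C.messageMatrix t) = y := by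
  simp [messageSpace, LinearMap.mem_range]

theorem mem_errorSpace {t : V} {p : Finset E} {y : N.In t → F} :
    y ∈ C.errorSpace t p ↔
      ∃ Z : E → F, (∀ e, e ∉ p → Z e = 0) ∧ Matrix.vecMul Z (C.errorMatrix t) = y := by
  simp [errorSpace, Submodule.mem_map, Submodule.mem_pi]

end NetworkCode

namespace MulticastNetwork

variable {V E : Type*} [Fintype E] [DecidableEq V] [DecidableEq E] (N : MulticastNetwork V E)
  (F : Type*) [Field F]

/-- The error pattern `p` is dominated by `q` with respect to `t`: for any linear network code
over `F`, the error space of `p` is contained in that of `q`. -/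
def Dominated (t : V) (p q : Finset E) : Prop :=
  ∀ (n : ℕ) (C : NetworkCode N F n), C.errorSpace t p ≤ C.errorSpace t q

/-- The rank of the error pattern `p` with respect to `t`: the least cardinality of an error
pattern that dominates `p`. -/
noncomputable def patternRank (t : V) (p : Finset E) : ℕ :=
  sInf {m | ∃ q : Finset E, N.Dominated F t p q ∧ q.card = m}

/-- The set `R_t(δ)` of the error patterns `p` with `|p| = rank_t(p) = δ`. -/
def rankPatterns (t : V) (δ : ℕ) : Set (Finset E) :=
  {p | p.card = δ ∧ N.patternRank F t p = δ}

end MulticastNetwork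

namespace NetworkCode

variable {V E F : Type*} [Fintype E] [DecidableEq V] [DecidableEq E] [Field F]
  {N : MulticastNetwork V E} {n : ℕ} (C : NetworkCode N F n)

/-- The minimum distance of a (regular) code at the sink `t`. For a regular code of positive
dimension the set is nonempty. -/
noncomputable def minDist (t : V) : ℕ :=
  sInf {m | ∃ p : Finset E,
    0 < Module.finrank F ↥(C.errorSpace t p ⊓ C.messageSpace t) ∧ N.patternRank F t p = m}

/-- A network MDS code: a regular code that attains the refined Singleton bound
`d_min = C_t - n + 1` at every sink `t`. -/
def IsMDS : Prop :=
  C.IsRegular ∧ ∀ t ∈ N.sinks, (C.minDist t : ℤ) = (N.capacity t : ℤ) - (n : ℤ) + 1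

end NetworkCode

/-! The construction fixes one code `C` of the largest dimension ω and obtains every smaller
dimension by precoding at the source, so the kernels at the internal nodes never change. Call a
pattern independent at t if its size equals its rank. `C` is chosen to resolve every independent
pattern p of size C_t - ω at every sink: messages and errors in p are jointly determined by what t
receives. For a single pair (t, p), Menger's theorem (`exists_linkage`, `exists_network_linkage`)
gives disjoint paths from the ω messages and p to t, and routing along them resolves p. Resolving is
a full-rank condition on a linear system that is affine in each coding coefficient, so once it holds
it is lost for at most one value of each coefficient. With fewer pairs than field elements, one
choice of coefficients serves all pairs (`exists_forall_resolves`). For n ≤ ω, an independent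
pattern of size C_t - n contains an independent one of size C_t - ω, so the messages it can confuse
form a subspace of dimension at most ω - n. Fewer than |F| such subspaces of F^ω are avoided by a
common n-dimensional space of messages (`exists_isMDS_precode`). This suffices for MDS: every
pattern of rank at most C_t - n is dominated by an independent one, which extends to size C_t - n,
while part of a minimum cut gives the opposite bound (`isMDS_of_forall_rankPatterns`). -/

/-! ### Avoidance arguments over a large enough field -/

/-- Finitely many conditions on a point of `ι → F`, fewer than `F` has elements, hold together at
some point if each of them holds at some point and, once it holds at a point, fails for at most one
value of each coordinate. -/
theorem exists_forall_of_coordinatewise {ι F J : Type*} [Finite ι] [DecidableEq ι] [Fintype F]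
    [Nonempty F] (s : Finset J) (hs : s.card < Fintype.card F) (P : J → (ι → F) → Prop)
    (hP : ∀ j ∈ s, ∃ x, P j x)
    (hline : ∀ j ∈ s, ∀ x, P j x → ∀ i a b, a ≠ b →
      P j (Function.update x i a) ∨ P j (Function.update x i b)) :
    ∃ x, ∀ j ∈ s, P j x := by
  classical
  have := Fintype.ofFinite ι
  -- The coordinates in `u` are fixed one at a time. Each condition keeps a witness of its own that
  -- agrees with `x` on `u`, and forbids at most one value of the next coordinate.
  suffices h : ∀ u : Finset ι, ∃ x : ι → F, ∀ j ∈ s, ∃ y, (∀ i ∈ u, y i = x i) ∧ P j y by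
    obtain ⟨x, hx⟩ := h Finset.univ
    refine ⟨x, fun j hj => ?_⟩
    obtain ⟨y, hy, hPy⟩ := hx j hj
    rwa [show y = x from funext fun i => hy i (Finset.mem_univ i)] at hPy
  intro u
  induction u using Finset.induction_on with
  | empty => exact ⟨fun _ => Classical.arbitrary F, fun j hj => by simpa using hP j hj⟩
  | insert i u hi ih =>
    obtain ⟨x, hx⟩ := ih
    choose! y hy hPy using hx
    let bad : J → Finset F := fun j => Finset.univ.filter fun a => ¬ P j (Function.update (y j) i a)
    have hbad : (s.biUnion bad).card < Fintype.card F := by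
      refine lt_of_le_of_lt (Finset.card_biUnion_le_card_mul s bad 1 fun j hj => ?_) (by simpa)
      refine Finset.card_le_one.2 fun a ha b hb => by_contra fun hab => ?_
      rw [Finset.mem_filter] at ha hb
      exact (hline j hj _ (hPy j hj) i a b hab).elim ha.2 hb.2
    obtain ⟨a, ha⟩ : ∃ a, a ∉ s.biUnion bad := by
      by_contra! h
      rw [Finset.eq_univ_iff_forall.2 h, Finset.card_univ] at hbad
      exact hbad.false
    refine ⟨Function.update x i a, fun j hj => ⟨Function.update (y j) i a, fun k hk => ?_, ?_⟩⟩
    · rcases eq_or_ne k i with rfl | hki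
      · simp
      · rw [Function.update_of_ne hki, Function.update_of_ne hki]
        exact hy j hj k (Finset.mem_of_mem_insert_of_ne hk hki)
    · by_contra h
      exact ha (Finset.mem_biUnion.2 ⟨j, hj, Finset.mem_filter.2 ⟨Finset.mem_univ a, h⟩⟩)

/-- Fewer than `|F|` proper subspaces do not cover `ι → F`. -/
theorem exists_forall_notMem_of_card_lt {ι F J : Type*} [Finite ι] [Field F] [Fintype F]
    (s : Finset J) (hs : s.card < Fintype.card F) (B : J → Submodule F (ι → F))
    (hB : ∀ j ∈ s, B j ≠ ⊤) : ∃ v, ∀ j ∈ s, v ∉ B j := by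
  classical
  refine exists_forall_of_coordinatewise s hs (fun j v => v ∉ B j) (fun j hj => ?_) ?_
  · by_contra! h
    exact hB j hj (eq_top_iff.2 fun v _ => h v)
  · intro j _ x hx i a b hab
    by_contra! h
    have hd := (B j).sub_mem h.1 h.2
    -- Two points of `B j` on a line in direction `i` force the unit vector into `B j`, hence the
    -- whole line, including `x`.
    have hsingle : (Pi.single i 1 : ι → F) ∈ B j := by
      convert (B j).smul_mem (a - b)⁻¹ hd using 1
      ext k
      rcases eq_or_ne k i with rfl | hk
      · simp [inv_mul_cancel₀ (sub_ne_zero.2 hab)]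
      · simp [hk]
    apply hx
    convert (B j).add_mem h.1 ((B j).smul_mem (x i - a) hsingle) using 1
    ext k
    rcases eq_or_ne k i with rfl | hk
    · simp
    · simp [hk]

/-- Fewer than `|F|` subspaces of dimension at most `dim - n` have a common `n`-dimensional
subspace meeting each of them trivially; it is given as the image of an injection. -/
theorem exists_injective_forall_disjoint {ι F J : Type*} [Fintype ι] [Field F] [Fintype F]
    (s : Finset J) (hs : s.card < Fintype.card F) (n : ℕ) (hn : n ≤ Fintype.card ι)
    (B : J → Submodule F (ι → F))
    (hB : ∀ j ∈ s, Module.finrank F (B j) + n ≤ Fintype.card ι) :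
    ∃ T : Matrix (Fin n) ι F, ∀ j ∈ s, ∀ X : Fin n → F, Matrix.vecMul X T ∈ B j → X = 0 := by
  induction n generalizing B with
  | zero => exact ⟨0, fun j _ X _ => Subsingleton.elim _ _⟩
  | succ n ih =>
    obtain ⟨v, hv⟩ := exists_forall_notMem_of_card_lt s hs B fun j hj h => by
      have := hB j hj
      rw [h, finrank_top, Module.finrank_fintype_fun_eq_card] at this
      omega
    -- The remaining rows must avoid `B j` even modulo `v`; enlarging `B j` by `v` costs at most one
    -- dimension.
    obtain ⟨T, hT⟩ := ih (by omega) (fun j => B j ⊔ Submodule.span F {v}) fun j hj => by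
      have h1 := Submodule.finrank_add_le_finrank_add_finrank (B j) (Submodule.span F {v})
      have h2 : Module.finrank F (Submodule.span F {v}) ≤ 1 :=
        (finrank_span_le_card {v}).trans (by simp)
      have := hB j hj
      omega
    refine ⟨Matrix.of (Fin.cons v T), fun j hj X hX => ?_⟩
    have hsplit : Matrix.vecMul X (Matrix.of (Fin.cons v T)) =
        X 0 • v + Matrix.vecMul (Fin.tail X) T := by
      ext k
      simp only [Matrix.vecMul, dotProduct, Fin.sum_univ_succ]
      rfl
    rw [hsplit] at hX
    have htail : Fin.tail X = 0 := by
      refine hT j hj _ ?_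
      have := Submodule.sub_mem _ (Submodule.mem_sup_left hX :
          _ ∈ B j ⊔ Submodule.span F {v})
        (Submodule.mem_sup_right (Submodule.smul_mem _ (X 0) (Submodule.mem_span_singleton_self v)))
      simpa using this
    rw [htail, Matrix.zero_vecMul, add_zero] at hX
    have h0 : X 0 = 0 := by
      by_contra h
      exact hv j hj (((B j).smul_mem_iff h).1 hX)
    ext k
    refine Fin.cases h0 (fun i => congrFun htail i) k

/-! ### Menger's theorem and linkages -/

/-- Menger's theorem in matching form.  If the separator given by each set `S` has at least as many
elements as `A`, then there is an injection sending each `x` to `inr x` (with `x ∈ B`) or to some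
`inl y` with `y ∉ A` that is equal to `x` or a successor of `x`. -/
theorem exists_linkage {X : Type*} [Fintype X] [DecidableEq X] (R : X → X → Prop)
    [DecidableRel R] (A B : Finset X)
    (hsep : ∀ S : Finset X, A.card ≤
      (A \ S ∪ (Finset.univ.filter fun y => y ∉ S ∧ ∃ x ∈ S, R x y) ∪ (S ∩ B)).card) :
    ∃ f : X → X ⊕ X, Function.Injective f ∧
      ∀ x, (∃ y, f x = Sum.inl y ∧ y ∉ A ∧ (y = x ∨ R x y)) ∨ (f x = Sum.inr x ∧ x ∈ B) := by
  let N : X → Finset (X ⊕ X) := fun x =>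
    (Finset.univ.filter fun y => y ∉ A ∧ (y = x ∨ R x y)).disjSum ({x} ∩ B)
  -- Hall's condition: the targets available to `S` are `S \ A`, the new successors outside `A`, and
  -- the exits `S ∩ B`. The separator bound makes the last two number at least `|A ∩ S|`.
  have hall : ∀ S : Finset X, S.card ≤ (S.biUnion N).card := by
    intro S
    have hN : S.biUnion N = ((S \ A) ∪
        ((Finset.univ.filter fun y => y ∉ S ∧ ∃ x ∈ S, R x y) \ A)).disjSum (S ∩ B) := by
      ext z
      rcases z with y | y
      · simp only [N, Finset.mem_biUnion, Finset.inl_mem_disjSum, Finset.mem_filter,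
          Finset.mem_univ, true_and, Finset.mem_union, Finset.mem_sdiff]
        constructor
        · rintro ⟨x, hx, hy, rfl | hR⟩
          · exact Or.inl ⟨hx, hy⟩
          · by_cases hyS : y ∈ S
            · exact Or.inl ⟨hyS, hy⟩
            · exact Or.inr ⟨⟨hyS, x, hx, hR⟩, hy⟩
        · rintro (⟨hy, hA⟩ | ⟨⟨_, x, hx, hR⟩, hA⟩)
          · exact ⟨y, hy, hA, Or.inl rfl⟩
          · exact ⟨x, hx, hA, Or.inr hR⟩
      · simp [N]
    rw [hN, Finset.card_disjSum, Finset.card_union_of_disjoint]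
    · have h1 := hsep S
      rw [Finset.union_assoc] at h1
      have h3 := Finset.card_sdiff_add_card_inter A S
      have h4 := Finset.card_sdiff_add_card_inter S A
      rw [Finset.inter_comm] at h4
      -- New successors that lie in `A` are already counted in `A \ S`.
      have h5 : A \ S ∪ ((Finset.univ.filter fun y => y ∉ S ∧ ∃ x ∈ S, R x y) ∪ S ∩ B) ⊆
          A \ S ∪ (((Finset.univ.filter fun y => y ∉ S ∧ ∃ x ∈ S, R x y) \ A) ∪ S ∩ B) := by
        intro y
        simp only [Finset.mem_union, Finset.mem_sdiff, Finset.mem_filter]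
        by_cases hy : y ∈ A <;> by_cases hyS : y ∈ S <;> simp [hy, hyS]
      have h6 := (h1.trans (Finset.card_le_card h5)).trans (Finset.card_union_le _ _)
      have h7 := Finset.card_union_le
        ((Finset.univ.filter fun y => y ∉ S ∧ ∃ x ∈ S, R x y) \ A) (S ∩ B)
      omega
    · rw [Finset.disjoint_left]
      intro y hy hy'
      simp only [Finset.mem_sdiff, Finset.mem_filter] at hy hy'
      exact hy'.1.2.1 hy.1
  obtain ⟨f, hf, hfN⟩ := (Finset.all_card_le_biUnion_card_iff_exists_injective N).1 hall
  refine ⟨f, hf, fun x => ?_⟩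
  have hx := hfN x
  rcases h : f x with y | y
  · rw [h] at hx
    simp only [N, Finset.inl_mem_disjSum, Finset.mem_filter, Finset.mem_univ, true_and] at hx
    exact Or.inl ⟨y, rfl, hx⟩
  · rw [h] at hx
    simp only [N, Finset.inr_mem_disjSum, Finset.mem_inter, Finset.mem_singleton] at hx
    exact Or.inr ⟨by rw [hx.1], hx.1 ▸ hx.2⟩

/-- Along the 0/1 coefficients of a linkage, a signal that obeys the recursion outside `A` and
vanishes on `B` is zero. -/
theorem eq_zero_of_linkage {X F : Type*} [Fintype X] [DecidableEq X] [Semiring F] {R : X → X → Prop}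
    (hR : WellFounded (flip R)) {A B : Finset X} {f : X → X ⊕ X} (hf : Function.Injective f)
    (hfx : ∀ x, (∃ y, f x = Sum.inl y ∧ y ∉ A ∧ (y = x ∨ R x y)) ∨ (f x = Sum.inr x ∧ x ∈ B))
    (y : X → F)
    (hA : ∀ e, e ∉ A → y e = ∑ d, (if f d = Sum.inl e ∧ d ≠ e then 1 else 0) * y d)
    (hB : ∀ e ∈ B, y e = 0) : y = 0 := by
  ext x
  induction x using hR.induction with
  | _ x ih =>
    rcases hfx x with ⟨e, he, heA, hxe⟩ | ⟨_, hx⟩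
    · have hd : ∀ d, f d = Sum.inl e → d = x := fun d h => hf (h.trans he.symm)
      by_cases hex : e = x
      · subst hex
        rw [hA e heA]
        refine Finset.sum_eq_zero fun d _ => ?_
        rw [if_neg fun h => h.2 (hd d h.1), zero_mul]
      -- The only contribution to `e` comes from `x`, so the value at `x` is the value at its
      -- successor, which is zero by induction.
      · have h1 := ih e (hxe.resolve_left hex)
        rw [hA e heA, Finset.sum_eq_single x, if_pos ⟨he, Ne.symm hex⟩, one_mul] at h1
        · exact h1
        · intro d _ hdx
          rw [if_neg fun h => hdx (hd d h.1), zero_mul]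
        · simp
    · exact hB x hx

theorem WellFounded.flip_of_finite {X : Type*} [Finite X] {r : X → X → Prop}
    (hr : WellFounded r) : WellFounded (flip r) := by
  have : Std.Irrefl (flip (Relation.TransGen r)) := ⟨fun x h => hr.transGen.irrefl.irrefl x h⟩
  have : IsTrans X (flip (Relation.TransGen r)) := ⟨fun _ _ _ h h' => Relation.TransGen.trans h' h⟩
  exact Subrelation.wf (r := flip (Relation.TransGen r)) (fun h => Relation.TransGen.single h)
    (Finite.wellFounded_of_trans_of_irrefl _)

/-! ### Paths and cuts in terms of channels -/

namespace MulticastNetwork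

variable {V E : Type*} (N : MulticastNetwork V E)

/-- The successor relation on the channels and `n` imaginary message channels. -/
def Feeds (n : ℕ) : Fin n ⊕ E → Fin n ⊕ E → Prop
  | Sum.inl _, Sum.inr e => N.tail e = N.source
  | Sum.inr d, Sum.inr e => N.Adjacent d e
  | _, Sum.inl _ => False

theorem feeds_wellFounded [Finite E] (n : ℕ) : WellFounded (N.Feeds n) := by
  have hl : ∀ i : Fin n, Acc (N.Feeds n) (Sum.inl i) := fun i =>
    ⟨_, fun x hx => by cases x <;> exact hx.elim⟩
  refine ⟨fun x => ?_⟩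
  rcases x with i | e
  · exact hl i
  · induction e using N.adjacent_wellFounded.induction with
    | _ e ih =>
      refine ⟨_, fun x hx => ?_⟩
      rcases x with i | d
      · exact hl i
      · exact ih d hx

/-- The channel starts a path to the node `t` none of whose channels lies in `Q`. -/
inductive ReachesAvoiding (t : V) (Q : Finset E) : E → Prop
  | last {e : E} : N.head e = t → e ∉ Q → ReachesAvoiding t Q e
  | step {d e : E} : N.Adjacent d e → d ∉ Q → ReachesAvoiding t Q e → ReachesAvoiding t Q d

variable {N} {t : V} {Q : Finset E}

theorem ReachesAvoiding.notMem {e : E} (h : N.ReachesAvoiding t Q e) : e ∉ Q := by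
  cases h <;> assumption

theorem ReachesAvoiding.reflTransGen {e : E} (h : N.ReachesAvoiding t Q e) :
    Relation.ReflTransGen (fun u v => ∃ e, e ∉ Q ∧ N.tail e = u ∧ N.head e = v) (N.tail e) t := by
  induction h with
  | last h hQ => exact Relation.ReflTransGen.single ⟨_, hQ, rfl, h⟩
  | step h hQ _ ih => exact Relation.ReflTransGen.head ⟨_, hQ, rfl, h⟩ ih

theorem isCut_of_forall_not_reachesAvoiding {s : V} (hst : s ≠ t)
    (h : ∀ e, N.tail e = s → ¬ N.ReachesAvoiding t Q e) : N.IsCut Q s t := by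
  intro hpath
  have key : ∀ u, Relation.ReflTransGen
      (fun u v => ∃ e, e ∉ Q ∧ N.tail e = u ∧ N.head e = v) u t →
      u = t ∨ ∃ e, N.tail e = u ∧ N.ReachesAvoiding t Q e := by
    intro u hu
    induction hu using Relation.ReflTransGen.head_induction_on with
    | refl => exact Or.inl rfl
    | head h _ ih =>
      obtain ⟨e, he, rfl, hv⟩ := h
      rcases ih with ih | ⟨e', he', hr⟩
      · exact Or.inr ⟨e, rfl, .last (hv.trans ih) he⟩
      · exact Or.inr ⟨e, rfl, .step (hv.trans he'.symm) he hr⟩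
  rcases key s hpath with h' | ⟨e, he, hr⟩
  · exact hst h'
  · exact h e he hr

theorem capacity_le_card (hcut : N.IsCut Q N.source t) : N.capacity t ≤ Q.card :=
  Nat.sInf_le ⟨Q, hcut, rfl⟩

theorem exists_isCut_card_eq_capacity (h : 0 < N.capacity t) :
    ∃ Q : Finset E, N.IsCut Q N.source t ∧ Q.card = N.capacity t :=
  Nat.sInf_mem (Nat.nonempty_of_pos_sInf h)

end MulticastNetwork

/-! ### Signals and the errors that reproduce them -/

namespace NetworkCode

variable {V E F : Type*} [Fintype E] [DecidableEq V] [DecidableEq E] [Field F]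
  {N : MulticastNetwork V E} {n : ℕ} (C : NetworkCode N F n)

/-- The local encoding coefficient from a channel, possibly imaginary, to a channel; it is zero
unless the first feeds the second. -/
def coeff : Fin n ⊕ E → E → F
  | Sum.inl i, e => if h : N.tail e = N.source then C.sourceKernel i ⟨e, h⟩ else 0
  | Sum.inr d, e => if h : N.head d = N.tail e then C.kernel (N.tail e) ⟨d, h⟩ ⟨e, rfl⟩ else 0

omit [Fintype E] [DecidableEq E] in
theorem feeds_of_coeff_ne_zero {d : Fin n ⊕ E} {e : E} (h : C.coeff d e ≠ 0) :
    N.Feeds n d (Sum.inr e) := by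
  rcases d with i | d
  · by_contra h'
    exact h (dif_neg h')
  · by_contra h'
    exact h (dif_neg h')

/-- The extended global encoding kernels of all channels, including the imaginary ones. -/
noncomputable def channelKernel : Fin n ⊕ E → Fin n ⊕ E → F
  | Sum.inl i => Pi.single (Sum.inl i) 1
  | Sum.inr e => C.extKernel e

theorem extKernel_eq_sum_coeff (e : E) :
    C.extKernel e = ∑ d, C.coeff d e • C.channelKernel d + Pi.single (Sum.inr e) 1 := by
  rw [extKernel, Fintype.sum_sum_type]
  congr 1
  split_ifs with h
  · have h2 : ∀ d : E, C.coeff (Sum.inr d) e = 0 := fun d =>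
      dif_neg fun h' => N.head_ne_source d (h'.trans h)
    simp only [h2, zero_smul, Finset.sum_const_zero, add_zero]
    exact Finset.sum_congr rfl fun i _ => by rw [coeff, dif_pos h]; rfl
  · have h2 : ∀ i : Fin n, C.coeff (Sum.inl i) e = 0 := fun i => dif_neg h
    simp only [h2, zero_smul, Finset.sum_const_zero, zero_add]
    rw [← Fintype.sum_subtype_add_sum_subtype (fun d => N.head d = N.tail e),
      Finset.sum_eq_zero (s := Finset.univ (α := {d // ¬ N.head d = N.tail e})) fun d _ => by
        rw [coeff, dif_neg d.2, zero_smul], add_zero]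
    exact Finset.sum_congr rfl fun d _ => by rw [coeff, dif_pos d.2]; rfl

/-- The value carried by each channel, for an input consisting of a message and an error vector. -/
noncomputable def signal (v : Fin n ⊕ E → F) (x : Fin n ⊕ E) : F := v ⬝ᵥ C.channelKernel x

theorem signal_inl (v : Fin n ⊕ E → F) (i : Fin n) : C.signal v (Sum.inl i) = v (Sum.inl i) := by
  simp [signal, channelKernel]

theorem signal_inr (v : Fin n ⊕ E → F) (e : E) :
    C.signal v (Sum.inr e) = ∑ d, C.coeff d e * C.signal v d + v (Sum.inr e) := by
  simp only [signal]
  rw [channelKernel, extKernel_eq_sum_coeff, dotProduct_add, dotProduct_sum]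
  simp [dotProduct_smul]

/-- Acyclicity lets the recursion be solved in only one way, so a vector is recognised as a signal
by checking the recursion alone. -/
theorem eq_signal {v y : Fin n ⊕ E → F} (hl : ∀ i, y (Sum.inl i) = v (Sum.inl i))
    (hr : ∀ e, y (Sum.inr e) = ∑ d, C.coeff d e * y d + v (Sum.inr e)) : y = C.signal v := by
  ext x
  induction x using (N.feeds_wellFounded n).induction with
  | _ x ih =>
    rcases x with i | e
    · rw [hl, signal_inl]
    · rw [hr, signal_inr]
      congr 1
      refine Finset.sum_congr rfl fun d _ => ?_
      by_cases h : C.coeff d e = 0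
      · rw [h, zero_mul, zero_mul]
      · rw [ih d (C.feeds_of_coeff_ne_zero h)]

theorem vecMul_messageMatrix (X : Fin n → F) (t : V) :
    Matrix.vecMul X (C.messageMatrix t) = fun e => C.signal (Sum.elim X 0) (Sum.inr e.1) := by
  ext e
  simp [Matrix.vecMul, dotProduct, messageMatrix, decodingMatrix, signal, channelKernel]

theorem vecMul_errorMatrix (Z : E → F) (t : V) :
    Matrix.vecMul Z (C.errorMatrix t) = fun e => C.signal (Sum.elim 0 Z) (Sum.inr e.1) := by
  ext e
  simp [Matrix.vecMul, dotProduct, errorMatrix, decodingMatrix, signal, channelKernel]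

omit [DecidableEq E] in
/-- Values may be prescribed on any set of channels and propagated by the code elsewhere. -/
theorem exists_signal_extending (H : Set E) (g : E → F) :
    ∃ y : Fin n ⊕ E → F, (∀ i, y (Sum.inl i) = 0) ∧ (∀ e ∈ H, y (Sum.inr e) = g e) ∧
      ∀ e ∉ H, y (Sum.inr e) = ∑ d, C.coeff d e * y d := by
  classical
  let step : ∀ e : E, (∀ d, N.Adjacent d e → F) → F := fun e ih =>
    if e ∈ H then g e else
      ∑ d, if h : N.Adjacent d e then C.coeff (Sum.inr d) e * ih d h else 0
  refine ⟨Sum.elim 0 (N.adjacent_wellFounded.fix step), fun i => rfl, fun e he => ?_,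
    fun e he => ?_⟩
  · rw [Sum.elim_inr, WellFounded.fix_eq]
    exact if_pos he
  · rw [Sum.elim_inr, WellFounded.fix_eq, Fintype.sum_sum_type]
    simp only [step, if_neg he, Sum.elim_inl, Pi.zero_apply, mul_zero, Finset.sum_const_zero,
      zero_add, Sum.elim_inr]
    refine Finset.sum_congr rfl fun d _ => ?_
    split_ifs with h
    · rfl
    · rw [show C.coeff (Sum.inr d) e = 0 from dif_neg h, zero_mul]

/-- If `Q` meets every path from the support of the input `v` to `t`, then the output at `t` is
also produced by errors in `Q`. -/
theorem signal_mem_errorSpace {t : V} {Q : Finset E} {v : Fin n ⊕ E → F}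
    (hr : ∀ e, N.ReachesAvoiding t Q e → v (Sum.inr e) = 0)
    (hl : ∀ e, N.tail e = N.source → N.ReachesAvoiding t Q e → ∀ i, v (Sum.inl i) = 0) :
    (fun e : N.In t => C.signal v (Sum.inr e.1)) ∈ C.errorSpace t Q := by
  -- Keep the original signal on `Q` and on the channels reaching `t` around `Q`; elsewhere
  -- propagate with no input. A channel feeding one that reaches `t` around `Q` is itself of one of
  -- the two kinds, so the recursion can fail only on `Q`.
  obtain ⟨y, hy0, hyH, hyN⟩ := C.exists_signal_extending
    {e | N.ReachesAvoiding t Q e ∨ e ∈ Q} fun e => C.signal v (Sum.inr e)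
  -- The errors are exactly the discrepancies of `y` on `Q`.
  let Z : E → F := fun e => if e ∈ Q then y (Sum.inr e) - ∑ d, C.coeff d e * y d else 0
  have hy : y = C.signal (Sum.elim 0 Z) := by
    refine C.eq_signal (fun i => hy0 i) fun e => ?_
    by_cases heQ : e ∈ Q
    · simp [Z, heQ]
    · by_cases he : N.ReachesAvoiding t Q e
      · rw [hyH e (Or.inl he), signal_inr, hr e he]
        simp only [Sum.elim_inr, Z, if_neg heQ, add_zero]
        refine Finset.sum_congr rfl fun d _ => ?_
        by_cases hd : C.coeff d e = 0
        · rw [hd, zero_mul, zero_mul]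
        · have hfeed := C.feeds_of_coeff_ne_zero hd
          rcases d with i | d
          · rw [signal_inl, hl e hfeed he i, hy0]
          · rw [hyH d]
            by_cases hdQ : d ∈ Q
            · exact Or.inr hdQ
            · exact Or.inl (.step hfeed hdQ he)
      · rw [hyN e (by simp [he, heQ])]
        simp [Z, heQ]
  refine C.mem_errorSpace.2 ⟨Z, fun e he => if_neg he, ?_⟩
  rw [vecMul_errorMatrix, ← hy]
  ext e
  refine hyH e.1 ?_
  by_cases heQ : e.1 ∈ Q
  · exact Or.inr heQ
  · exact Or.inl (.last e.2 heQ)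

/-- The only signal on the network that enters through the message channels and the channels in
`p` and is not seen at `t` is zero. -/
def Resolves (t : V) (p : Finset E) : Prop :=
  ∀ y : Fin n ⊕ E → F, (∀ e, e ∉ p → y (Sum.inr e) = ∑ d, C.coeff d e * y d) →
    (∀ e, N.head e = t → y (Sum.inr e) = 0) → y = 0

/-- The code with the given local encoding coefficients. -/
def ofCoeff (N : MulticastNetwork V E) (K : (Fin n ⊕ E) × E → F) : NetworkCode N F n where
  sourceKernel := fun i e => K (Sum.inl i, e.1)
  kernel := fun _ d e => K (Sum.inr d.1, e.1)

omit [Fintype E] [DecidableEq E] in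
open Classical in
theorem coeff_ofCoeff (K : (Fin n ⊕ E) × E → F) (d : Fin n ⊕ E) (e : E) :
    (ofCoeff N K).coeff d e = if N.Feeds n d (Sum.inr e) then K (d, e) else 0 := by
  rcases d with i | d
  · by_cases h : N.tail e = N.source <;> simp [coeff, ofCoeff, MulticastNetwork.Feeds, h]
  · by_cases h : N.head d = N.tail e <;>
      simp [coeff, ofCoeff, MulticastNetwork.Feeds, MulticastNetwork.Adjacent, h]

/-- One coefficient perturbs the linear system by rank one. Nonzero invisible signals for two
different values of it would combine to a nonzero invisible signal for the original value. -/
theorem Resolves.update_or_update {t : V} {p : Finset E} {K : (Fin n ⊕ E) × E → F}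
    (h : (ofCoeff N K).Resolves t p) (c : (Fin n ⊕ E) × E) {a b : F} (hab : a ≠ b) :
    (ofCoeff N (Function.update K c a)).Resolves t p ∨
      (ofCoeff N (Function.update K c b)).Resolves t p := by
  classical
  obtain ⟨x, e₀⟩ := c
  let κ : F := if N.Feeds n x (Sum.inr e₀) then 1 else 0
  have hsum : ∀ (a : F) (y : Fin n ⊕ E → F) (e : E),
      ∑ d, (ofCoeff N (Function.update K (x, e₀) a)).coeff d e * y d =
        ∑ d, (ofCoeff N K).coeff d e * y d +
          if e = e₀ then κ * (a - K (x, e₀)) * y x else 0 := by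
    intro a y e
    have hd : ∀ d, (ofCoeff N (Function.update K (x, e₀) a)).coeff d e * y d =
        (ofCoeff N K).coeff d e * y d +
          if d = x then (if e = e₀ then κ * (a - K (x, e₀)) * y x else 0) else 0 := by
      intro d
      rw [coeff_ofCoeff, coeff_ofCoeff]
      by_cases hdx : d = x
      · subst hdx
        by_cases he : e = e₀
        · subst he
          simp only [κ, Function.update_self, if_true]
          split_ifs <;> ring
        · rw [Function.update_of_ne (by simp [he])]
          simp [he]
      · rw [Function.update_of_ne (by simp [hdx])]
        simp [hdx]
    rw [Finset.sum_congr rfl fun d _ => hd d, Finset.sum_add_distrib, Finset.sum_ite_eq']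
    simp
  by_contra! hcon
  obtain ⟨h1, h2⟩ := hcon
  unfold Resolves at h1 h2
  push Not at h1 h2
  obtain ⟨y, hy, hyt, hy0⟩ := h1
  obtain ⟨z, hz, hzt, hz0⟩ := h2
  simp only [hsum] at hy hz
  -- If `y` vanished at `x`, the changed coefficient would not matter and `y` would contradict `h`.
  have hyx : y x ≠ 0 := fun hx => hy0 (h y (fun e he => by simpa [hx] using hy e he) hyt)
  have hzx : z x ≠ 0 := fun hx => hz0 (h z (fun e he => by simpa [hx] using hz e he) hzt)
  -- The weights cancel the perturbation terms at `e₀`; at `x` the combination equals `(b - a) * y x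
  -- * z x`.
  have hw := h (((b - K (x, e₀)) * z x) • y - ((a - K (x, e₀)) * y x) • z) (fun e he => by
    have h3 : ∀ d, (ofCoeff N K).coeff d e *
        (((b - K (x, e₀)) * z x) • y - ((a - K (x, e₀)) * y x) • z) d =
        ((b - K (x, e₀)) * z x) * ((ofCoeff N K).coeff d e * y d) -
          ((a - K (x, e₀)) * y x) * ((ofCoeff N K).coeff d e * z d) := fun d => by
      simp only [Pi.sub_apply, Pi.smul_apply, smul_eq_mul]
      ring
    rw [Finset.sum_congr rfl fun d _ => h3 d, Finset.sum_sub_distrib, ← Finset.mul_sum,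
      ← Finset.mul_sum]
    simp only [Pi.sub_apply, Pi.smul_apply, smul_eq_mul]
    rw [hy e he, hz e he]
    split_ifs <;> ring) (fun e he => by simp [hyt e he, hzt e he])
  have hwx := congrFun hw x
  simp only [Pi.sub_apply, Pi.smul_apply, smul_eq_mul, Pi.zero_apply] at hwx
  have : (b - a) * (y x * z x) = 0 := by linear_combination hwx
  exact mul_ne_zero (sub_ne_zero.2 hab.symm) (mul_ne_zero hyx hzx) this

end NetworkCode

/-! ### Error spaces, domination and rank -/

namespace NetworkCode

variable {V E F : Type*} [Fintype E] [DecidableEq V] [DecidableEq E] [Field F]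
  {N : MulticastNetwork V E} {n : ℕ} (C : NetworkCode N F n) {t : V}

theorem errorSpace_mono {p q : Finset E} (h : p ⊆ q) : C.errorSpace t p ≤ C.errorSpace t q := by
  intro y hy
  obtain ⟨Z, hZ, rfl⟩ := C.mem_errorSpace.1 hy
  exact C.mem_errorSpace.2 ⟨Z, fun e he => hZ e fun he' => he (h he'), rfl⟩

theorem errorSpace_union (p q : Finset E) :
    C.errorSpace t (p ∪ q) = C.errorSpace t p ⊔ C.errorSpace t q := by
  refine le_antisymm (fun y hy => ?_) (sup_le (C.errorSpace_mono Finset.subset_union_left)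
    (C.errorSpace_mono Finset.subset_union_right))
  obtain ⟨Z, hZ, rfl⟩ := C.mem_errorSpace.1 hy
  have hsplit : Z = (fun e => if e ∈ p then Z e else 0) + fun e => if e ∈ p then 0 else Z e := by
    ext e
    by_cases he : e ∈ p <;> simp [he]
  rw [hsplit, Matrix.add_vecMul]
  refine Submodule.add_mem_sup (C.mem_errorSpace.2 ⟨_, fun e he => if_neg he, rfl⟩)
    (C.mem_errorSpace.2 ⟨_, fun e he => ?_, rfl⟩)
  by_cases hep : e ∈ p
  · exact if_pos hep
  · exact (if_neg hep).trans (hZ e (by simp [hep, he]))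

theorem finrank_errorSpace_le (p : Finset E) : Module.finrank F (C.errorSpace t p) ≤ p.card := by
  have hle : C.errorSpace t p ≤
      LinearMap.range ((C.errorMatrix t).submatrix (Subtype.val : p → E) id).vecMulLinear := by
    intro y hy
    obtain ⟨Z, hZ, rfl⟩ := C.mem_errorSpace.1 hy
    refine ⟨fun e => Z e.1, ?_⟩
    ext x
    simp only [Matrix.coe_vecMulLinear, Matrix.vecMul, dotProduct, Matrix.submatrix_apply, id]
    rw [Finset.sum_coe_sort p fun e => Z e * C.errorMatrix t e x]
    exact Finset.sum_subset (Finset.subset_univ p) fun e _ he => by rw [hZ e he, zero_mul]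
  refine (Submodule.finrank_mono hle).trans ((LinearMap.finrank_range_le _).trans ?_)
  simp

theorem card_le_finrank_errorSpace {p : Finset E}
    (h : ∀ Z : E → F, (∀ e, e ∉ p → Z e = 0) → Matrix.vecMul Z (C.errorMatrix t) = 0 → Z = 0) :
    p.card ≤ Module.finrank F (C.errorSpace t p) := by
  let ext0 : (p → F) →ₗ[F] (E → F) := Function.ExtendByZero.linearMap F (Subtype.val : p → E)
  have happ : ∀ (z : p → F) (e : E), e ∉ p → ext0 z e = 0 := fun z e he =>
    Function.extend_apply' _ _ _ fun ⟨a, ha⟩ => he (ha ▸ a.2)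
  let φ := (C.errorMatrix t).vecMulLinear ∘ₗ ext0
  have hφ : Function.Injective φ := by
    refine LinearMap.ker_eq_bot.1 (LinearMap.ker_eq_bot'.2 fun z hz => ?_)
    have h0 := h (ext0 z) (happ z) hz
    ext e
    have := congrFun h0 e.1
    rwa [show ext0 z e.1 = z e from Subtype.val_injective.extend_apply _ _ _] at this
  have hle : LinearMap.range φ ≤ C.errorSpace t p := by
    rintro _ ⟨z, rfl⟩
    exact C.mem_errorSpace.2 ⟨ext0 z, happ z, rfl⟩
  have := Submodule.finrank_mono hle
  rw [LinearMap.finrank_range_of_inj hφ] at this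
  simpa using this

end NetworkCode

namespace MulticastNetwork

variable {V E : Type*} [Fintype E] [DecidableEq V] [DecidableEq E] {N : MulticastNetwork V E}
  {F : Type*} [Field F] {t : V}

theorem Dominated.trans {p q r : Finset E} (h : N.Dominated F t p q) (h' : N.Dominated F t q r) :
    N.Dominated F t p r := fun n C => (h n C).trans (h' n C)

theorem Dominated.patternRank_le {p q : Finset E} (h : N.Dominated F t p q) :
    N.patternRank F t p ≤ q.card := Nat.sInf_le ⟨q, h, rfl⟩

theorem dominated_refl (p : Finset E) : N.Dominated F t p p := fun _ _ => le_rfl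

theorem patternRank_le_card (p : Finset E) : N.patternRank F t p ≤ p.card :=
  (dominated_refl p).patternRank_le

theorem exists_dominated_card_eq_patternRank (N : MulticastNetwork V E) (F : Type*) [Field F]
    (t : V) (p : Finset E) :
    ∃ q, N.Dominated F t p q ∧ q.card = N.patternRank F t p :=
  Nat.sInf_mem (s := {m | ∃ q, N.Dominated F t p q ∧ q.card = m})
    ⟨p.card, p, dominated_refl p, rfl⟩

/-- Any error pattern is dominated by one that is independent and of the same rank. -/
theorem exists_dominated_mem_rankPatterns (N : MulticastNetwork V E) (F : Type*) [Field F]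
    (t : V) (p : Finset E) :
    ∃ q, N.Dominated F t p q ∧ q ∈ N.rankPatterns F t (N.patternRank F t p) := by
  obtain ⟨q, hpq, hq⟩ := exists_dominated_card_eq_patternRank N F t p
  obtain ⟨r, hqr, hr⟩ := exists_dominated_card_eq_patternRank N F t q
  refine ⟨q, hpq, hq, le_antisymm ((patternRank_le_card q).trans_eq hq) ?_⟩
  exact (hpq.trans hqr).patternRank_le.trans_eq hr

/-- Independence is hereditary: a smaller pattern dominating `p` could replace `p` inside `q` and
would lower the rank of `q`. -/
theorem patternRank_eq_card_of_subset {p q : Finset E} (hpq : p ⊆ q)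
    (hq : N.patternRank F t q = q.card) : N.patternRank F t p = p.card := by
  refine le_antisymm (patternRank_le_card p) ?_
  obtain ⟨r, hpr, hr⟩ := exists_dominated_card_eq_patternRank N F t p
  have hdom : N.Dominated F t q (r ∪ q \ p) := fun n C => by
    rw [C.errorSpace_union, ← Finset.union_sdiff_of_subset hpq, C.errorSpace_union]
    refine sup_le_sup (hpr n C) ?_
    rw [Finset.union_sdiff_of_subset hpq]
  have h1 := hdom.patternRank_le.trans (Finset.card_union_le _ _)
  have h2 := Finset.card_sdiff_add_card_eq_card hpq
  omega

/-- Errors on channels separating `p` from `t` can imitate any error in `p`. This bounds the rank,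
which quantifies over all codes, by the size of a cut. -/
theorem dominated_of_forall_not_reachesAvoiding {p Q : Finset E}
    (h : ∀ e ∈ p, ¬ N.ReachesAvoiding t Q e) : N.Dominated F t p Q := by
  intro n C y hy
  obtain ⟨Z, hZ, rfl⟩ := C.mem_errorSpace.1 hy
  rw [C.vecMul_errorMatrix]
  exact C.signal_mem_errorSpace (fun e he => hZ e fun hep => h e hep he) fun _ _ _ _ => rfl

/-- One code certifies independence: there the error space of `p` has dimension `p.card`, and that
of a dominating `q` has dimension at most `q.card`. -/
theorem patternRank_eq_card_of_code {n : ℕ} (C : NetworkCode N F n) {p : Finset E}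
    (h : ∀ Z : E → F, (∀ e, e ∉ p → Z e = 0) → Matrix.vecMul Z (C.errorMatrix t) = 0 → Z = 0) :
    N.patternRank F t p = p.card := by
  refine le_antisymm (patternRank_le_card p) ?_
  obtain ⟨q, hpq, hq⟩ := exists_dominated_card_eq_patternRank N F t p
  exact hq ▸ (C.card_le_finrank_errorSpace h).trans
    ((Submodule.finrank_mono (hpq n C)).trans (C.finrank_errorSpace_le q))

/-- From `m` message channels together with an independent error pattern `p` there is a linkage to
the sink, as long as the total number of these does not exceed the capacity. -/
theorem exists_network_linkage (ht : N.source ≠ t) {m : ℕ} {p : Finset E}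
    (hp : N.patternRank F t p = p.card) (hm : m + p.card ≤ N.capacity t) :
    ∃ f : Fin m ⊕ E → (Fin m ⊕ E) ⊕ (Fin m ⊕ E), Function.Injective f ∧
      ∀ x, (∃ y, f x = Sum.inl y ∧ y ∉ Finset.univ.disjSum p ∧ (y = x ∨ N.Feeds m x y)) ∨
        (f x = Sum.inr x ∧
          x ∈ (∅ : Finset (Fin m)).disjSum (Finset.univ.filter fun e => N.head e = t)) := by
  classical
  refine exists_linkage (N.Feeds m) _ _ fun S => ?_
  set A : Finset (Fin m ⊕ E) := Finset.univ.disjSum p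
  set B : Finset (Fin m ⊕ E) := (∅ : Finset (Fin m)).disjSum
    (Finset.univ.filter fun e => N.head e = t)
  set Q := A \ S ∪ (Finset.univ.filter fun y => y ∉ S ∧ ∃ x ∈ S, N.Feeds m x y) ∪ (S ∩ B) with hQ
  have hcard : Q.toLeft.card + Q.toRight.card = Q.card := Finset.card_toLeft_add_card_toRight
  have hA : A.card = m + p.card := by simp [A]
  have hAQ : ∀ x ∈ A, x ∉ Q → x ∈ S := by
    intro x hx hxQ
    by_contra hxS
    exact hxQ (by simp [hQ, hx, hxS])
  have hstep : ∀ x ∈ S, ∀ y, N.Feeds m x y → y ∉ Q → y ∈ S := by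
    intro x hx y hxy hyQ
    by_contra hyS
    refine hyQ ?_
    simp only [hQ, Finset.mem_union, Finset.mem_filter, Finset.mem_univ, true_and]
    exact Or.inl (Or.inr ⟨hyS, x, hx, hxy⟩)
  -- A path starting in `S` either leaves `S` through a new successor or ends in `S ∩ B`; both lie
  -- in `Q`.
  have hreach : ∀ e, N.ReachesAvoiding t Q.toRight e → Sum.inr e ∉ S := by
    intro e he
    induction he with
    | @last e h heQ =>
      intro heS
      refine heQ (Finset.mem_toRight.2 ?_)
      simp only [hQ, Finset.mem_union, Finset.mem_inter]
      exact Or.inr ⟨heS, by simp [B, h]⟩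
    | @step d e hde hdQ he ih =>
      intro hdS
      refine ih (hstep _ hdS _ hde fun h => he.notMem (Finset.mem_toRight.2 h))
  rw [hA]
  -- If `Q` contains all message channels, its real channels separate `p` from `t`, and independence
  -- gives at least `p.card` of them. Otherwise a message channel outside `Q` lies in `S`, and the
  -- real channels of `Q` cut the source from `t`.
  by_cases hall : ∀ i : Fin m, Sum.inl i ∈ Q
  · have h1 : Q.toLeft.card = m := by
      rw [Finset.eq_univ_iff_forall.2 fun i => Finset.mem_toLeft.2 (hall i)]
      simp
    have h2 : N.Dominated F t p Q.toRight := by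
      refine dominated_of_forall_not_reachesAvoiding fun e hep he => hreach e he ?_
      exact hAQ _ (by simp [A, hep]) fun h => he.notMem (Finset.mem_toRight.2 h)
    have := h2.patternRank_le
    omega
  · push Not at hall
    obtain ⟨i, hi⟩ := hall
    have h2 : N.IsCut Q.toRight N.source t := by
      refine isCut_of_forall_not_reachesAvoiding ht fun e hes he => hreach e he ?_
      exact hstep _ (hAQ _ (by simp [A]) hi) _ (show N.Feeds m (Sum.inl i) (Sum.inr e) from hes)
        fun h => he.notMem (Finset.mem_toRight.2 h)
    have := capacity_le_card h2
    omega

end MulticastNetwork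

/-! ### Routing codes and extension of independent patterns -/

namespace NetworkCode

variable {V E F : Type*} [Fintype E] [DecidableEq V] [DecidableEq E] [Field F]
  {N : MulticastNetwork V E} {m : ℕ} {t : V} {p : Finset E}
  {f : Fin m ⊕ E → (Fin m ⊕ E) ⊕ (Fin m ⊕ E)}

/-- The routing code of a linkage. -/
noncomputable def ofLinkage (N : MulticastNetwork V E) (F : Type*) [Field F]
    (f : Fin m ⊕ E → (Fin m ⊕ E) ⊕ (Fin m ⊕ E)) : NetworkCode N F m :=
  ofCoeff N fun c => if f c.1 = Sum.inl (Sum.inr c.2) ∧ c.1 ≠ Sum.inr c.2 then 1 else 0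

theorem coeff_ofLinkage
    (hfx : ∀ x, (∃ y, f x = Sum.inl y ∧ y ∉ Finset.univ.disjSum p ∧ (y = x ∨ N.Feeds m x y)) ∨
        (f x = Sum.inr x ∧
          x ∈ (∅ : Finset (Fin m)).disjSum (Finset.univ.filter fun e => N.head e = t)))
    (d : Fin m ⊕ E) (e : E) : (ofLinkage N F f).coeff d e =
      if f d = Sum.inl (Sum.inr e) ∧ d ≠ Sum.inr e then 1 else 0 := by
  classical
  rw [ofLinkage, coeff_ofCoeff]
  by_cases h : f d = Sum.inl (Sum.inr e) ∧ d ≠ Sum.inr e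
  · refine if_pos ?_
    rcases hfx d with ⟨y, hy, _, hdy⟩ | ⟨hd, _⟩
    · obtain rfl : y = Sum.inr e := Sum.inl_injective (hy.symm.trans h.1)
      exact hdy.resolve_left fun h' => h.2 h'.symm
    · rw [hd] at h
      exact absurd h.1 (by simp)
  · simp [h]

theorem resolves_ofLinkage (hf : Function.Injective f)
    (hfx : ∀ x, (∃ y, f x = Sum.inl y ∧ y ∉ Finset.univ.disjSum p ∧ (y = x ∨ N.Feeds m x y)) ∨
        (f x = Sum.inr x ∧
          x ∈ (∅ : Finset (Fin m)).disjSum (Finset.univ.filter fun e => N.head e = t))) :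
    (ofLinkage N F f).Resolves t p := by
  intro y hy hyt
  refine eq_zero_of_linkage (N.feeds_wellFounded m).flip_of_finite hf hfx y (fun x hx => ?_)
    fun x hx => ?_
  · rcases x with i | e
    · simp at hx
    · rw [hy e (by simpa using hx)]
      exact Finset.sum_congr rfl fun d _ => by rw [coeff_ofLinkage hfx]
  · rcases x with i | e
    · simp at hx
    · exact hyt e (by simpa using hx)

/-- An independent error pattern extends to an independent one of any larger size up to the
capacity. -/
theorem _root_.MulticastNetwork.exists_subset_mem_rankPatterns (ht : N.source ≠ t) {δ : ℕ}
    (hp : N.patternRank F t p = p.card) (hpδ : p.card ≤ δ) (hδ : δ ≤ N.capacity t) :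
    ∃ q ∈ N.rankPatterns F t δ, p ⊆ q := by
  classical
  obtain ⟨m, rfl⟩ := Nat.exists_eq_add_of_le' hpδ
  obtain ⟨f, hf, hfx⟩ := MulticastNetwork.exists_network_linkage ht hp hδ
  -- A message channel lies in the starting set and is no exit, so its path moves on to a real
  -- channel outside `p`. These first channels `σ i` are the ones added to `p`.
  have hfirst : ∀ i : Fin m, ∃ e : E, f (Sum.inl i) = Sum.inl (Sum.inr e) ∧ e ∉ p := by
    intro i
    rcases hfx (Sum.inl i) with ⟨y, hy, hyA, _⟩ | ⟨_, hi⟩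
    · rcases y with j | e
      · simp at hyA
      · exact ⟨e, hy, by simpa using hyA⟩
    · simp at hi
  choose σ hσ hσp using hfirst
  have hσinj : Function.Injective σ := fun i j hij => by
    have := (hσ i).trans ((congrArg (fun e => Sum.inl (Sum.inr e)) hij).trans (hσ j).symm)
    exact Sum.inl_injective (hf this)
  have hdisj : Disjoint (Finset.univ.image σ) p := by
    rw [Finset.disjoint_left]
    intro e he
    obtain ⟨i, _, rfl⟩ := Finset.mem_image.1 he
    exact hσp i
  have hcard : (Finset.univ.image σ ∪ p).card = m + p.card := by
    rw [Finset.card_union_of_disjoint hdisj, Finset.card_image_of_injective _ hσinj]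
    simp
  have hc := coeff_ofLinkage (F := F) hfx
  have hsingle : ∀ i (y : Fin m ⊕ E → F),
      ∑ d, (ofLinkage N F f).coeff d (σ i) * y d = y (Sum.inl i) := by
    intro i y
    rw [Finset.sum_eq_single (Sum.inl i), hc, if_pos ⟨hσ i, by simp⟩, one_mul]
    · intro d _ hd
      rw [hc, if_neg fun h => hd (hf (h.1.trans (hσ i).symm)), zero_mul]
    · simp
  refine ⟨Finset.univ.image σ ∪ p, ⟨hcard, ?_⟩, Finset.subset_union_right⟩
  rw [← hcard]
  refine MulticastNetwork.patternRank_eq_card_of_code (ofLinkage N F f) fun Z hZ hZ0 => ?_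
  let y : Fin m ⊕ E → F := (ofLinkage N F f).signal (Sum.elim 0 Z)
  have hyr : ∀ e, y (Sum.inr e) = ∑ d, (ofLinkage N F f).coeff d e * y d + Z e := fun e =>
    signal_inr _ _ e
  have hyl : ∀ i, y (Sum.inl i) = 0 := fun i => signal_inl _ _ i
  have hl0 : ∀ i e, e ∉ Finset.univ.image σ →
      (ofLinkage N F f).coeff (Sum.inl i) e = 0 := by
    intro i e he
    rw [hc, if_neg]
    rintro ⟨h, -⟩
    rw [hσ i] at h
    simp only [Sum.inl.injEq, Sum.inr.injEq] at h
    exact he (Finset.mem_image.2 ⟨i, Finset.mem_univ i, h⟩)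
  -- Errors on the channels `σ i` are traded for messages with the values found there; the resulting
  -- signal has errors in `p` only and is still invisible at `t`.
  have hz := resolves_ofLinkage (F := F) hf hfx
    (Sum.elim (fun i => y (Sum.inr (σ i))) fun e => y (Sum.inr e)) (fun e he => ?_) fun e he => ?_
  · have hyr0 : ∀ x, y x = 0 := by
      rintro (i | e)
      · exact hyl i
      · exact congrFun hz (Sum.inr e)
    ext e
    have := hyr e
    simp only [hyr0, mul_zero, Finset.sum_const_zero, zero_add] at this
    exact this.symm
  · by_cases heσ : e ∈ Finset.univ.image σ
    · obtain ⟨i, _, rfl⟩ := Finset.mem_image.1 heσ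
      rw [hsingle]
      rfl
    · rw [Sum.elim_inr, hyr e, hZ e (by simp only [Finset.mem_union]; tauto), add_zero]
      refine Finset.sum_congr rfl fun d _ => ?_
      rcases d with i | d
      · rw [hl0 i e heσ, zero_mul, zero_mul]
      · rfl
  · rw [vecMul_errorMatrix] at hZ0
    exact congrFun hZ0 ⟨e, he⟩

end NetworkCode

/-! ### Precoding, confusable messages and the MDS criterion -/

namespace NetworkCode

variable {V E F : Type*} [Fintype E] [DecidableEq V] [DecidableEq E] [Field F]
  {N : MulticastNetwork V E} {n : ℕ} (C : NetworkCode N F n) {t : V}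

-- A message and an error with the same output at `t` differ by an invisible signal, which must
-- vanish.
variable {C} in
theorem Resolves.eq_zero {p : Finset E} (h : C.Resolves t p) {X : Fin n → F}
    (hX : Matrix.vecMul X (C.messageMatrix t) ∈ C.errorSpace t p) : X = 0 := by
  obtain ⟨Z, hZ, hZX⟩ := C.mem_errorSpace.1 hX
  rw [vecMul_errorMatrix, vecMul_messageMatrix] at hZX
  have hy := h (C.signal (Sum.elim X 0) - C.signal (Sum.elim 0 Z)) (fun e he => ?_) fun e he => ?_
  · ext i
    simpa [signal_inl] using congrFun hy (Sum.inl i)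
  · rw [Pi.sub_apply, signal_inr, signal_inr]
    simp [hZ e he, mul_sub, Finset.sum_sub_distrib]
  · rw [Pi.sub_apply, sub_eq_zero]
    exact (congrFun hZX ⟨e, he⟩).symm

/-- The code obtained by applying a linear precoding to the messages at the source. -/
def precode {k : ℕ} (T : Matrix (Fin k) (Fin n) F) : NetworkCode N F k where
  sourceKernel := T * C.sourceKernel
  kernel := C.kernel

theorem signal_precode {k : ℕ} (T : Matrix (Fin k) (Fin n) F) (X : Fin k → F) (Z : E → F) (e : E) :
    (C.precode T).signal (Sum.elim X Z) (Sum.inr e) =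
      C.signal (Sum.elim (Matrix.vecMul X T) Z) (Sum.inr e) := by
  have h := (C.precode T).eq_signal (v := Sum.elim X Z)
    (y := Sum.elim X fun e => C.signal (Sum.elim (Matrix.vecMul X T) Z) (Sum.inr e))
    (fun i => rfl) fun e => ?_
  · rw [← h]
    rfl
  · rw [Sum.elim_inr, signal_inr, Sum.elim_inr, Sum.elim_inr, Fintype.sum_sum_type,
      Fintype.sum_sum_type]
    congr 2
    simp only [Sum.elim_inl, signal_inl]
    by_cases hs : N.tail e = N.source
    · have h1 : ∀ i, (C.precode T).coeff (Sum.inl i) e =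
          ∑ j, T i j * C.sourceKernel j ⟨e, hs⟩ := fun i => dif_pos hs
      have h2 : ∀ j, C.coeff (Sum.inl j) e = C.sourceKernel j ⟨e, hs⟩ := fun j => dif_pos hs
      simp only [h1, h2, Matrix.vecMul, dotProduct, Finset.mul_sum, Finset.sum_mul]
      rw [Finset.sum_comm]
      exact Finset.sum_congr rfl fun i _ => Finset.sum_congr rfl fun j _ => by ring
    · have h1 : ∀ i, (C.precode T).coeff (Sum.inl i) e = 0 := fun i => dif_neg hs
      have h2 : ∀ j, C.coeff (Sum.inl j) e = 0 := fun j => dif_neg hs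
      simp [h1, h2]

theorem vecMul_messageMatrix_precode {k : ℕ} (T : Matrix (Fin k) (Fin n) F) (X : Fin k → F) :
    Matrix.vecMul X ((C.precode T).messageMatrix t) =
      Matrix.vecMul (Matrix.vecMul X T) (C.messageMatrix t) := by
  ext e
  rw [vecMul_messageMatrix, vecMul_messageMatrix]
  exact C.signal_precode T X 0 e

theorem errorSpace_precode {k : ℕ} (T : Matrix (Fin k) (Fin n) F) (p : Finset E) :
    (C.precode T).errorSpace t p = C.errorSpace t p := by
  have h : ∀ Z : E → F, Matrix.vecMul Z ((C.precode T).errorMatrix t) =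
      Matrix.vecMul Z (C.errorMatrix t) := fun Z => by
    ext e
    rw [vecMul_errorMatrix, vecMul_errorMatrix]
    exact (C.signal_precode T 0 Z e).trans (by rw [Matrix.zero_vecMul])
  ext y
  simp only [mem_errorSpace, h]

/-- The messages whose transmission can be confused at `t` with errors in `p`. -/
noncomputable def confusable (t : V) (p : Finset E) : Submodule F (Fin n → F) :=
  (C.errorSpace t p).comap (C.messageMatrix t).vecMulLinear

theorem mem_confusable {p : Finset E} {X : Fin n → F} :
    X ∈ C.confusable t p ↔ Matrix.vecMul X (C.messageMatrix t) ∈ C.errorSpace t p := Iff.rfl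

-- Modulo the error space of `p` messages still embed, while the error space of `q` becomes the
-- image of that of `q \ p`.
variable {C} in
theorem Resolves.finrank_confusable_le {p q : Finset E} (h : C.Resolves t p) (hpq : p ⊆ q) :
    Module.finrank F (C.confusable t q) ≤ (q \ p).card := by
  let φ := (C.errorSpace t p).mkQ ∘ₗ (C.messageMatrix t).vecMulLinear
  have hφ : Function.Injective φ := by
    refine LinearMap.ker_eq_bot.1 (LinearMap.ker_eq_bot'.2 fun X hX => h.eq_zero ?_)
    exact (Submodule.Quotient.mk_eq_zero _).1 hX
  have hle : (C.confusable t q).map φ ≤ (C.errorSpace t (q \ p)).map (C.errorSpace t p).mkQ := by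
    rintro _ ⟨X, hX, rfl⟩
    have hX' : Matrix.vecMul X (C.messageMatrix t) ∈ C.errorSpace t q := hX
    rw [← Finset.union_sdiff_of_subset hpq, errorSpace_union] at hX'
    obtain ⟨y, hy, z, hz, hyz⟩ := Submodule.mem_sup.1 hX'
    refine ⟨z, hz, ?_⟩
    have : φ X = (C.errorSpace t p).mkQ (y + z) := by
      rw [hyz]
      rfl
    have hy0 : (C.errorSpace t p).mkQ y = 0 := (Submodule.Quotient.mk_eq_zero _).2 hy
    rw [this, map_add, hy0, zero_add]
  calc Module.finrank F (C.confusable t q)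
      = Module.finrank F ((C.confusable t q).map φ) :=
        (Submodule.equivMapOfInjective φ hφ _).finrank_eq
    _ ≤ Module.finrank F ((C.errorSpace t (q \ p)).map (C.errorSpace t p).mkQ) :=
        Submodule.finrank_mono hle
    _ ≤ Module.finrank F (C.errorSpace t (q \ p)) := Submodule.finrank_map_le _ _
    _ ≤ (q \ p).card := C.finrank_errorSpace_le _

/-- Errors on a cut can imitate every message; this is the source of the Singleton bound. -/
theorem messageSpace_le_errorSpace_of_isCut {Q : Finset E} (hQ : N.IsCut Q N.source t) :
    C.messageSpace t ≤ C.errorSpace t Q := by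
  intro y hy
  obtain ⟨X, rfl⟩ := C.mem_messageSpace.1 hy
  rw [vecMul_messageMatrix]
  refine C.signal_mem_errorSpace (fun _ _ => rfl) fun e he hr => ?_
  exact absurd (he ▸ hr.reflTransGen) hQ

/-- A code with no message confusable with the errors in an independent error pattern of size
`C_t - n` is a network MDS code. -/
theorem isMDS_of_forall_rankPatterns (hn : 1 ≤ n) (hcap : ∀ t ∈ N.sinks, n ≤ N.capacity t)
    (h : ∀ t ∈ N.sinks, ∀ p ∈ N.rankPatterns F t (N.capacity t - n),
      ∀ X, X ∈ C.confusable t p → X = 0) : C.IsMDS := by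
  have hzero : ∀ t ∈ N.sinks, ∀ p, N.patternRank F t p ≤ N.capacity t - n →
      ∀ X, X ∈ C.confusable t p → X = 0 := by
    intro t ht p hp X hX
    obtain ⟨q, hpq, hq, hq'⟩ := MulticastNetwork.exists_dominated_mem_rankPatterns N F t p
    obtain ⟨r, hr, hqr⟩ := MulticastNetwork.exists_subset_mem_rankPatterns (F := F)
      (fun hst => N.source_notMem_sinks (hst ▸ ht)) (hq'.trans hq.symm) (hq.trans_le hp)
      (Nat.sub_le _ _)
    exact h t ht r hr X (C.errorSpace_mono hqr (hpq n C hX))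
  have hreg : C.IsRegular := by
    intro t ht
    have hinj : Function.Injective (C.messageMatrix t).vecMulLinear := by
      refine LinearMap.ker_eq_bot.1 (LinearMap.ker_eq_bot'.2 fun X hX => ?_)
      -- Regularity is the case of no errors.
      refine hzero t ht ∅ ((MulticastNetwork.patternRank_le_card ∅).trans (by simp)) X ?_
      rw [mem_confusable, ← Matrix.vecMulLinear_apply, hX]
      exact Submodule.zero_mem _
    rw [messageSpace, LinearMap.finrank_range_of_inj hinj, Module.finrank_fin_fun]
  refine ⟨hreg, fun t ht => ?_⟩
  have hnC := hcap t ht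
  -- Positive capacity excludes the default value of `sInf ∅`, so a minimum cut exists.
  obtain ⟨Q, hQ, hQc⟩ := MulticastNetwork.exists_isCut_card_eq_capacity (hn.trans hnC)
  obtain ⟨p, hpQ, hpc⟩ := Finset.exists_subset_card_eq (s := Q) (n := N.capacity t - n + 1)
    (by omega)
  -- Only `n - 1` channels of `Q` remain outside `p`, too few for their errors to account for all
  -- `n` message dimensions modulo the errors in `p`.
  have hpos : 0 < Module.finrank F ↥(C.errorSpace t p ⊓ C.messageSpace t) := by
    have h1 := Submodule.finrank_sup_add_finrank_inf_eq (C.errorSpace t p) (C.messageSpace t)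
    have h2 : C.errorSpace t p ⊔ C.messageSpace t ≤
        C.errorSpace t p ⊔ C.errorSpace t (Q \ p) := by
      rw [← C.errorSpace_union, Finset.union_sdiff_of_subset hpQ]
      exact sup_le (C.errorSpace_mono hpQ) (C.messageSpace_le_errorSpace_of_isCut hQ)
    have h3 := (Submodule.finrank_mono h2).trans (Submodule.finrank_add_le_finrank_add_finrank _ _)
    have h4 := C.finrank_errorSpace_le (t := t) (Q \ p)
    have h5 := Finset.card_sdiff_add_card_eq_card hpQ
    have h6 := hreg t ht
    omega
  have hub : C.minDist t ≤ N.patternRank F t p := Nat.sInf_le ⟨p, hpos, rfl⟩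
  have hub' := hub.trans (MulticastNetwork.patternRank_le_card p)
  obtain ⟨q, hq, hqd⟩ : ∃ q : Finset E, 0 < Module.finrank F
      ↥(C.errorSpace t q ⊓ C.messageSpace t) ∧ N.patternRank F t q = C.minDist t :=
    Nat.sInf_mem (s := {m | ∃ q : Finset E, 0 < Module.finrank F
      ↥(C.errorSpace t q ⊓ C.messageSpace t) ∧ N.patternRank F t q = m}) ⟨_, p, hpos, rfl⟩
  have hlb : N.capacity t - n < C.minDist t := by
    rw [← hqd]
    by_contra! hle
    refine hq.ne' ((Submodule.finrank_eq_zero).2 ((Submodule.eq_bot_iff _).2 fun y hy => ?_))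
    obtain ⟨X, rfl⟩ := C.mem_messageSpace.1 hy.2
    rw [hzero t ht q hle X hy.1, Matrix.zero_vecMul]
  omega

/-! ### Construction of the codes -/

/-- Over a field with more elements than there are error patterns to resolve, one code resolves
all the independent error patterns of size `C_t - n` at all the sinks. -/
theorem exists_forall_resolves [Fintype F] (N : MulticastNetwork V E) (n : ℕ)
    (hcap : ∀ t ∈ N.sinks, n ≤ N.capacity t)
    (hF : ∑ t ∈ N.sinks, (N.rankPatterns F t (N.capacity t - n)).ncard < Fintype.card F) :
    ∃ C : NetworkCode N F n, ∀ t ∈ N.sinks, ∀ p ∈ N.rankPatterns F t (N.capacity t - n),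
      C.Resolves t p := by
  classical
  let s : Finset (Σ _ : V, Finset E) := N.sinks.sigma fun t =>
    (N.rankPatterns F t (N.capacity t - n)).toFinset
  have hs : s.card < Fintype.card F := by
    rw [Finset.card_sigma]
    simpa only [Set.ncard_eq_toFinset_card'] using hF
  have hmem : ∀ {j}, j ∈ s ↔ j.1 ∈ N.sinks ∧ j.2 ∈ N.rankPatterns F j.1 (N.capacity j.1 - n) := by
    simp [s]
  have hex : ∀ j ∈ s, ∃ K : (Fin n ⊕ E) × E → F, (ofCoeff N K).Resolves j.1 j.2 := by
    intro j hj
    obtain ⟨ht, hp, hp'⟩ := hmem.1 hj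
    obtain ⟨f, hf, hfx⟩ := MulticastNetwork.exists_network_linkage (F := F) (m := n)
      (fun hst => N.source_notMem_sinks (hst ▸ ht)) (hp'.trans hp.symm)
      (by have := hcap _ ht; omega)
    exact ⟨_, resolves_ofLinkage hf hfx⟩
  obtain ⟨K, hK⟩ := exists_forall_of_coordinatewise s hs
    (fun j (K : (Fin n ⊕ E) × E → F) => (ofCoeff N K).Resolves j.1 j.2) hex
    fun j _ K hK c a b hab => hK.update_or_update c hab
  exact ⟨ofCoeff N K, fun t ht p hp => hK ⟨t, p⟩ (hmem.2 ⟨ht, hp⟩)⟩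

/-- A code resolving all the independent error patterns of size `C_t - ω` can be precoded to a
network MDS code of any smaller positive dimension. -/
theorem exists_isMDS_precode [Fintype F] {ω : ℕ} (C : NetworkCode N F ω)
    (hcap : ∀ t ∈ N.sinks, ω ≤ N.capacity t)
    (hC : ∀ t ∈ N.sinks, ∀ p ∈ N.rankPatterns F t (N.capacity t - ω), C.Resolves t p)
    (hn : 1 ≤ n) (hnω : n ≤ ω)
    (hF : ∑ t ∈ N.sinks, (N.rankPatterns F t (N.capacity t - n)).ncard < Fintype.card F) :
    ∃ T : Matrix (Fin n) (Fin ω) F, (C.precode T).IsMDS := by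
  classical
  let s : Finset (Σ _ : V, Finset E) := N.sinks.sigma fun t =>
    (N.rankPatterns F t (N.capacity t - n)).toFinset
  have hs : s.card < Fintype.card F := by
    rw [Finset.card_sigma]
    simpa only [Set.ncard_eq_toFinset_card'] using hF
  have hmem : ∀ {j}, j ∈ s ↔ j.1 ∈ N.sinks ∧ j.2 ∈ N.rankPatterns F j.1 (N.capacity j.1 - n) := by
    simp [s]
  obtain ⟨T, hT⟩ := exists_injective_forall_disjoint s hs n (by simpa using hnω)
    (fun j => C.confusable j.1 j.2) fun j hj => by
      obtain ⟨ht, hp, hp'⟩ := hmem.1 hj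
      have hω := hcap _ ht
      -- A subpattern of size `C_t - ω` is independent and hence resolved by `C`, which leaves at
      -- most `(C_t - n) - (C_t - ω) = ω - n` confusable dimensions.
      obtain ⟨q, hqp, hq⟩ := Finset.exists_subset_card_eq (s := j.2) (n := N.capacity j.1 - ω)
        (by omega)
      have hres := hC _ ht q ⟨hq, (MulticastNetwork.patternRank_eq_card_of_subset hqp
        (hp'.trans hp.symm)).trans hq⟩
      have h1 := hres.finrank_confusable_le hqp
      have h2 := Finset.card_sdiff_add_card_eq_card hqp
      rw [Fintype.card_fin]
      omega
  refine ⟨T, isMDS_of_forall_rankPatterns _ hn (fun t ht => hnω.trans (hcap t ht)) ?_⟩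
  intro t ht p hp X hX
  refine hT ⟨t, p⟩ (hmem.2 ⟨ht, hp⟩) X ?_
  rwa [mem_confusable, ← vecMul_messageMatrix_precode, ← C.errorSpace_precode T, ← mem_confusable]

end NetworkCode

theorem mainTheorem2 {V E F : Type*} [Finite V] [Fintype E] [DecidableEq V] [DecidableEq E]
    [Field F] [Fintype F] (N : MulticastNetwork V E) (ω : ℕ) (hω : 1 ≤ ω)
    (hωC : ∀ t ∈ N.sinks, ω ≤ N.capacity t)
    (hF : ((Finset.range ω).sup fun i =>
        ∑ t ∈ N.sinks, (N.rankPatterns F t (N.capacity t - ω + i)).ncard) < Fintype.card F) :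
    ∃ C : (n : ℕ) → NetworkCode N F n,
      (∀ n ∈ Finset.Icc 1 ω, (C n).IsMDS) ∧
      ∀ m ∈ Finset.Icc 1 ω, ∀ n ∈ Finset.Icc 1 ω, ∀ i ∈ N.internalNodes,
        (C m).kernel i = (C n).kernel i := by
  have hF' : ∀ n, 1 ≤ n → n ≤ ω →
      ∑ t ∈ N.sinks, (N.rankPatterns F t (N.capacity t - n)).ncard < Fintype.card F := by
    intro n hn hnω
    refine lt_of_le_of_lt ?_ hF
    refine le_trans (le_of_eq (Finset.sum_congr rfl fun t ht => ?_))
      (Finset.le_sup (f := fun i => ∑ t ∈ N.sinks,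
        (N.rankPatterns F t (N.capacity t - ω + i)).ncard) (Finset.mem_range.2 (by omega : ω - n < ω)))
    have := hωC t ht
    -- Dimension `n` corresponds to the index `i = ω - n`; the truncated subtractions are exact
    -- because `n ≤ ω ≤ C_t`.
    rw [show N.capacity t - n = N.capacity t - ω + (ω - n) by omega]
  obtain ⟨C, hC⟩ := NetworkCode.exists_forall_resolves N ω hωC (hF' ω hω le_rfl)
  have hT : ∀ n, ∃ T : Matrix (Fin n) (Fin ω) F, n ∈ Finset.Icc 1 ω → (C.precode T).IsMDS := by
    intro n
    by_cases hn : n ∈ Finset.Icc 1 ω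
    · obtain ⟨h1, h2⟩ := Finset.mem_Icc.1 hn
      obtain ⟨T, hT⟩ := C.exists_isMDS_precode hωC hC h1 h2 (hF' n h1 h2)
      exact ⟨T, fun _ => hT⟩
    · exact ⟨0, fun h => absurd h hn⟩
  choose T hT using hT
  -- Precoding alters the source kernel only, so the kernels agree by definition.
  exact ⟨fun n => C.precode (T n), fun n hn => hT n hn, fun _ _ _ _ _ _ => rfl⟩
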